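/- Let $N$ be a connected compact smooth manifold without boundary, and let $P^0 = N\times(0,\infty)$ be the open infinite cylinder over $N$, with points $\mathbf{x}=(y,r)$ and $\mathbf{x}'=(y',r')$. Let $g^\partial$ be a smooth family of Riemannian metrics on $N$ parametrized by $[0,\infty]$; that is, $r\mapsto g^\partial(r)$ is a family of Riemannian metrics on $N$, smooth in $(y,r)\in N\times[0,\infty)$, and, in the coordinate $R=1/r$, it extends to a family $R\mapsto \hat g^\partial(R)$ of Riemannian metrics on $N$, smooth in $(y,R)\in N\times[0,\infty)$, with $\hat g^\partial(1/r)=g^\partial(r)$ for all $r>0$. Consider the model conic metrics $$g^0 = dr^2 + r^2 g^\partial(r) \quad\text{on } N\times[0,\infty)_r, \qquad g^\infty = dR^2 + R^2\, \hat g^\partial(R)\quad\text{on } N\times[0,\infty)_R,$$ and the conic inversion $\iota^0:P^0\to P^0$, $\iota^0(y,r)=(y,1/r)$. Let $d^0$ be the Riemannian distance on $P^0$ of $g^0$, and let $d^\infty$ be the Riemannian distance on $P^0$ of the pullback $(\iota^0)^*g^\infty$ (which equals $r^{-4}g^0$). Then there exist constants $A',B'>0$ such that for all $\mathbf{x}=(y,r)$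 and $\mathbf{x}'=(y',r')$ in $P^0$, $$A'\, d^0(\mathbf{x},\mathbf{x}') \;\le\; r\, r'\, d^\infty(\mathbf{x},\mathbf{x}') \;\le\; B'\, d^0(\mathbf{x},\mathbf{x}').$$ -/

import Mathlib

open Set
open scoped Manifold ContDiff ENNReal

noncomputable section

namespace ConicInversion

/-- The open half-line `(0, ∞)`, as an open submanifold of `ℝ`. -/
def HalfLine : TopologicalSpace.Opens ℝ := ⟨Ioi 0, isOpen_Ioi⟩

/-- The open infinite cylinder `P⁰ = N × (0, ∞)`, with its product manifold structure. -/
abbrev OpenCylinder (N : Type*) := N × HalfLine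

/-- A (not necessarily continuous) field of bilinear forms on the tangent spaces of `M`. -/
abbrev TensorField {E : Type*} [NormedAddCommGroup E] [NormedSpace ℝ E]
    {H : Type*} [TopologicalSpace H] (I : ModelWithCorners ℝ E H)
    (M : Type*) [TopologicalSpace M] [ChartedSpace H M] :=
  ∀ x : M, TangentSpace I x →L[ℝ] TangentSpace I x →L[ℝ] ℝ

/-- The pullback of a continuous bilinear form `b` under a continuous linear map `L`:
`(v, w) ↦ b (L v) (L w)`. -/
def pullbackForm {V W : Type*} [AddCommGroup V] [Module ℝ V] [TopologicalSpace V]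
    [AddCommGroup W] [Module ℝ W] [TopologicalSpace W]
    (b : W →L[ℝ] W →L[ℝ] ℝ) (L : V →L[ℝ] W) : V →L[ℝ] V →L[ℝ] ℝ :=
  (ContinuousLinearMap.precomp ℝ L).comp (b.comp L)

theorem pullbackForm_apply {V W : Type*} [AddCommGroup V] [Module ℝ V] [TopologicalSpace V]
    [AddCommGroup W] [Module ℝ W] [TopologicalSpace W]
    (b : W →L[ℝ] W →L[ℝ] ℝ) (L : V →L[ℝ] W) (v w : V) :
    pullbackForm b L v w = b (L v) (L w) := rfl

/-- The pullback `f^* g` of a tensor field `g` under a map `f` between manifolds: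
`(f^* g)_x (v, w) = g_{f x} (df_x v, df_x w)`. -/
def TensorField.pullback {E : Type*} [NormedAddCommGroup E] [NormedSpace ℝ E]
    {H : Type*} [TopologicalSpace H] {I : ModelWithCorners ℝ E H}
    {M : Type*} [TopologicalSpace M] [ChartedSpace H M]
    {E' : Type*} [NormedAddCommGroup E'] [NormedSpace ℝ E']
    {H' : Type*} [TopologicalSpace H'] {I' : ModelWithCorners ℝ E' H'}
    {M' : Type*} [TopologicalSpace M'] [ChartedSpace H' M']
    (f : M → M') (g : TensorField I' M') : TensorField I M :=
  fun x => pullbackForm (g (f x)) (mfderiv I I' f x)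

/-- The (extended) distance `d_g` of a Riemannian metric `g` on `M`: the infimum over the curves
joining two points of their length `∫ g(c'(t), c'(t))^{1/2} dt`. This is Mathlib's Riemannian
distance, for the norms `‖v‖ = g(v, v)^{1/2}` on the tangent spaces. -/
def TensorField.edist {E : Type*} [NormedAddCommGroup E] [NormedSpace ℝ E]
    {H : Type*} [TopologicalSpace H] {I : ModelWithCorners ℝ E H}
    {M : Type*} [TopologicalSpace M] [ChartedSpace H M]
    (g : TensorField I M) (x y : M) : ℝ≥0∞ :=
  letI : ∀ z : M, ENorm (TangentSpace I z) := fun z => ⟨fun v => ENNReal.ofReal √(g z v v)⟩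
  Manifold.riemannianEDist I x y

/-- A family `r ↦ g(r)`, `r ∈ [0, ∞)`, of Riemannian metrics on `N` that is smooth in
`(y, r) ∈ N × [0, ∞)`, up to and including `r = 0`. The values of `inner r` for `r < 0` carry no
meaning. -/
structure MetricFamily (E : Type*) [NormedAddCommGroup E] [NormedSpace ℝ E]
    (N : Type*) [TopologicalSpace N] [ChartedSpace E N] [IsManifold 𝓘(ℝ, E) ∞ N] where
  /-- The metric tensor `g(r)`. -/
  inner : ℝ → TensorField 𝓘(ℝ, E) N
  symm : ∀ r, 0 ≤ r → ∀ (y : N) (v w : TangentSpace 𝓘(ℝ, E) y),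
    inner r y v w = inner r y w v
  pos : ∀ r, 0 ≤ r → ∀ (y : N) (v : TangentSpace 𝓘(ℝ, E) y), v ≠ 0 → 0 < inner r y v v
  smooth : ContMDiffOn (𝓘(ℝ, E).prod 𝓘(ℝ, ℝ)) (𝓘(ℝ, E).prod 𝓘(ℝ, E →L[ℝ] E →L[ℝ] ℝ)) ∞
    (fun p : N × ℝ =>
      (Bundle.TotalSpace.mk' (E →L[ℝ] E →L[ℝ] ℝ) p.1 (inner p.2 p.1) :
        Bundle.TotalSpace (E →L[ℝ] E →L[ℝ] ℝ)
          (fun y : N => TangentSpace 𝓘(ℝ, E) y →L[ℝ] TangentSpace 𝓘(ℝ, E) y →L[ℝ] ℝ)))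
    (univ ×ˢ Ici 0)

section Cylinder

variable {E : Type*} [NormedAddCommGroup E] [NormedSpace ℝ E]
  {N : Type*} [TopologicalSpace N] [ChartedSpace E N] [IsManifold 𝓘(ℝ, E) ∞ N]

/-- The restriction to `P⁰` of the model conic metric `dr² + r² g(r)` of `N × [0, ∞)`. The tangent
space at `(y, r)` is `T_y N × ℝ`, with projections `dy` and `dr`. -/
def MetricFamily.modelConic (g : MetricFamily E N) :
    TensorField (𝓘(ℝ, E).prod 𝓘(ℝ, ℝ)) (OpenCylinder N) :=
  fun p =>
    let dy : TangentSpace (𝓘(ℝ, E).prod 𝓘(ℝ, ℝ)) p →L[ℝ] TangentSpace 𝓘(ℝ, E) p.1 :=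
      ContinuousLinearMap.fst ℝ E ℝ
    let dr : TangentSpace (𝓘(ℝ, E).prod 𝓘(ℝ, ℝ)) p →L[ℝ] ℝ :=
      ContinuousLinearMap.snd ℝ E ℝ
    pullbackForm (ContinuousLinearMap.mul ℝ ℝ) dr +
      ((p.2 : ℝ) ^ 2) • pullbackForm (g.inner p.2 p.1) dy

theorem MetricFamily.modelConic_apply (g : MetricFamily E N) (p : OpenCylinder N)
    (v w : E) (s t : ℝ) :
    g.modelConic p (v, s) (w, t) = s * t + (p.2 : ℝ) ^ 2 * g.inner p.2 p.1 v w := rfl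

/-- The conic inversion `ι⁰ : P⁰ → P⁰`, `(y, r) ↦ (y, 1 / r)`. -/
def inversion (p : OpenCylinder N) : OpenCylinder N :=
  (p.1, ⟨1 / (p.2 : ℝ), mem_Ioi.mpr (one_div_pos.mpr (mem_Ioi.mp p.2.2))⟩)

end Cylinder

end ConicInversion

end

/-! The inversion is an isometry from its pulled-back metric, which is `r⁻⁴ g⁰`, so `d^∞(x, x')` is
the distance of the inverted points in the cone at infinity. For the upper bound let `r ≤ r'` and
take a curve of `g⁰`-length `L` from `x` to `x'`. If `L ≤ r'/2`, the curve stays at radius at least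
`r'/2`, so inversion multiplies lengths by at most `4/r'²`, and `r r' ≤ r'²` absorbs this
(`mul_edist_inversion_le_of_length_le`). If `L ≥ r'/2`, a crude bound suffices: two points of a cone
are at distance at most a constant times the larger radius, here `1/r` (`edist_modelConic_le`), and
`r r' · (1/r) = r' ≤ 2L`. This constant is uniform because `N` is compact and connected and the
metrics extend smoothly to `r = 0` and `R = 0` (`exists_dominating`). The lower bound is the upper
bound with the two ends exchanged. -/

noncomputable section

namespace ConicInversion

open MeasureTheory

/-! ### Length and distance of a tensor field, and their behaviour under pullback. -/

section Length

variable {E : Type*} [NormedAddCommGroup E] [NormedSpace ℝ E]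
  {H : Type*} [TopologicalSpace H] {I : ModelWithCorners ℝ E H}
  {M : Type*} [TopologicalSpace M] [ChartedSpace H M]
  {E' : Type*} [NormedAddCommGroup E'] [NormedSpace ℝ E']
  {H' : Type*} [TopologicalSpace H'] {I' : ModelWithCorners ℝ E' H'}
  {M' : Type*} [TopologicalSpace M'] [ChartedSpace H' M']

/-- The norm `g(v, v)^{1/2}` of a tangent vector. -/
def TensorField.speed (g : TensorField I M) (x : M) (v : TangentSpace I x) : ℝ≥0∞ :=
  ENNReal.ofReal √(g x v v)

theorem TensorField.speed_smul (g : TensorField I M) (x : M) (c : ℝ) (v : TangentSpace I x) :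
    g.speed x (c • v) = ‖c‖ₑ * g.speed x v := by
  have h : g x (c • v) (c • v) = c ^ 2 * g x v v := by
    simp only [map_smul, smul_apply, smul_eq_mul]; ring
  rw [TensorField.speed, h, Real.sqrt_mul (sq_nonneg c), Real.sqrt_sq_eq_abs,
    ENNReal.ofReal_mul (abs_nonneg c), TensorField.speed, Real.enorm_eq_ofReal_abs]

/-- The length of a curve parametrized by `[0, 1]`. -/
def TensorField.length (g : TensorField I M) (γ : ℝ → M) : ℝ≥0∞ :=
  ∫⁻ t in Ioo (0 : ℝ) 1, g.speed (γ t) (mfderiv 𝓘(ℝ, ℝ) I γ t (1 : ℝ))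

theorem TensorField.edist_le_length (g : TensorField I M) {γ : ℝ → M} {x y : M}
    (hγ : ContMDiffOn 𝓘(ℝ, ℝ) I 1 γ (Icc 0 1)) (h0 : γ 0 = x) (h1 : γ 1 = y) :
    g.edist x y ≤ g.length γ := by
  -- This is by definition the norm chosen in `TensorField.edist`. Only its homogeneity is needed,
  -- not the triangle inequality.
  let : ∀ z : M, ENorm (TangentSpace I z) := fun z => ⟨fun v => g.speed z v⟩
  have : ∀ z : M, ENormSMulClass ℝ (TangentSpace I z) := fun z => ⟨g.speed_smul z⟩
  have h := Manifold.riemannianEDist_le_pathELength (I := I) hγ h0 h1 zero_le_one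
  rw [Manifold.pathELength_eq_lintegral_mfderiv_Ioo] at h
  exact h

theorem TensorField.exists_length_lt (g : TensorField I M) {x y : M} {L : ℝ≥0∞}
    (hL : g.edist x y < L) :
    ∃ γ : ℝ → M, γ 0 = x ∧ γ 1 = y ∧ ContMDiffOn 𝓘(ℝ, ℝ) I 1 γ (Icc 0 1) ∧ g.length γ < L := by
  let : ∀ z : M, ENorm (TangentSpace I z) := fun z => ⟨fun v => g.speed z v⟩
  obtain ⟨γ, h0, h1, hγ, h⟩ := Manifold.exists_lt_of_riemannianEDist_lt (I := I) hL
  rw [Manifold.pathELength_eq_lintegral_mfderiv_Ioo] at h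
  exact ⟨γ, h0, h1, hγ, h⟩

theorem TensorField.edist_comm (g : TensorField I M) (x y : M) : g.edist x y = g.edist y x := by
  let : ∀ z : M, ENorm (TangentSpace I z) := fun z => ⟨fun v => g.speed z v⟩
  have : ∀ z : M, ENormSMulClass ℝ (TangentSpace I z) := fun z => ⟨g.speed_smul z⟩
  exact Manifold.riemannianEDist_comm (I := I) (x := x) (y := y)

theorem mdifferentiableAt_of_mem_Ioo {γ : ℝ → M}
    (hγ : ContMDiffOn 𝓘(ℝ, ℝ) I 1 γ (Icc 0 1)) {t : ℝ} (ht : t ∈ Ioo (0 : ℝ) 1) :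
    MDifferentiableAt 𝓘(ℝ, ℝ) I γ t :=
  (hγ.contMDiffAt (Icc_mem_nhds ht.1 ht.2)).mdifferentiableAt one_ne_zero

theorem TensorField.speed_pullback (g : TensorField I' M') (f : M → M') (x : M)
    (v : TangentSpace I x) :
    (g.pullback f : TensorField I M).speed x v = g.speed (f x) (mfderiv I I' f x v) := rfl

theorem TensorField.length_pullback (g : TensorField I' M') {f : M → M'}
    (hf : ContMDiff I I' 1 f) {γ : ℝ → M} (hγ : ContMDiffOn 𝓘(ℝ, ℝ) I 1 γ (Icc 0 1)) :
    (g.pullback f : TensorField I M).length γ = g.length (f ∘ γ) := by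
  refine setLIntegral_congr_fun measurableSet_Ioo fun t ht => ?_
  rw [TensorField.speed_pullback, mfderiv_comp t ((hf _).mdifferentiableAt one_ne_zero)
    (mdifferentiableAt_of_mem_Ioo hγ ht)]
  rfl

/-- A smooth map does not increase distances when its source carries the pulled back tensor. -/
theorem TensorField.edist_map_le (g : TensorField I' M') {f : M → M'}
    (hf : ContMDiff I I' 1 f) (x y : M) :
    g.edist (f x) (f y) ≤ (g.pullback f : TensorField I M).edist x y := by
  refine le_of_forall_gt fun L hL => ?_
  obtain ⟨γ, h0, h1, hγ, h⟩ := TensorField.exists_length_lt _ hL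
  rw [g.length_pullback hf hγ] at h
  refine (g.edist_le_length (hf.comp_contMDiffOn hγ) ?_ ?_).trans_lt h <;> simp [h0, h1]

/-- An involution is an isometry from the pulled back tensor. -/
theorem TensorField.edist_pullback_involutive (g : TensorField I M) {f : M → M}
    (hf : ContMDiff I I 1 f) (hinv : Function.Involutive f) (x y : M) :
    (g.pullback f : TensorField I M).edist x y = g.edist (f x) (f y) := by
  refine le_antisymm (le_of_forall_gt fun L hL => ?_) (g.edist_map_le hf x y)
  obtain ⟨γ, h0, h1, hγ, h⟩ := g.exists_length_lt hL
  have hfγ : ContMDiffOn 𝓘(ℝ, ℝ) I 1 (f ∘ γ) (Icc 0 1) := hf.comp_contMDiffOn hγ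
  refine (TensorField.edist_le_length _ hfγ (by simp [h0, hinv x]) (by simp [h1, hinv y])).trans_lt ?_
  rwa [g.length_pullback hf hfγ, ← Function.comp_assoc, hinv.comp_self, Function.id_comp]

end Length

/-! ### Compactness: finite diameter of `N` and uniform bounds on a metric family. -/

theorem eventually_norm_lt_add_one {E : Type*} [NormedAddCommGroup E] [NormedSpace ℝ E]
    {X : Type*} [TopologicalSpace X]
    {f : X → E →L[ℝ] E →L[ℝ] ℝ} {s : Set X} {x : X} (hf : ContinuousWithinAt f s x) :
    ∀ᶠ p in nhdsWithin x s, ‖f p‖ < ‖f x‖ + 1 := by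
  have h := (continuous_norm (E := E →L[ℝ] E →L[ℝ] ℝ)).continuousAt.comp_continuousWithinAt hf
  exact Filter.Tendsto.eventually_lt_const (lt_add_one _) h

section Compact

open Bundle Filter Topology Manifold

variable {E : Type*} [NormedAddCommGroup E] [NormedSpace ℝ E]
  {N : Type*} [TopologicalSpace N] [ChartedSpace E N] [IsManifold 𝓘(ℝ, E) ∞ N]

/-- Unit balls are neighbourhoods of their centres, so the points at finite distance from `y₀` form
a clopen set, hence all of `N`. Compactness then makes the local bounds uniform. -/
theorem exists_riemannianEDist_le [CompactSpace N] [ConnectedSpace N]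
    [RiemannianBundle (fun y : N => TangentSpace 𝓘(ℝ, E) y)]
    [IsContinuousRiemannianBundle E (fun y : N => TangentSpace 𝓘(ℝ, E) y)] :
    ∃ D : ℝ≥0∞, D ≠ ⊤ ∧ ∀ y y' : N, riemannianEDist 𝓘(ℝ, E) y y' ≤ D := by
  let y₀ : N := Classical.arbitrary N
  let S : Set N := {y | riemannianEDist 𝓘(ℝ, E) y₀ y < ⊤}
  have hopen (P : N → Prop) (hP : ∀ y z, riemannianEDist 𝓘(ℝ, E) y z < 1 → P y → P z) :
      IsOpen {y | P y} := by
    rw [isOpen_iff_mem_nhds]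
    intro y hy
    filter_upwards [eventually_riemannianEDist_lt 𝓘(ℝ, E) y one_pos] with z hz
    exact hP y z hz hy
  have hstep (y z : N) (h : riemannianEDist 𝓘(ℝ, E) y z < 1)
      (hy : riemannianEDist 𝓘(ℝ, E) y₀ y < ⊤) : riemannianEDist 𝓘(ℝ, E) y₀ z < ⊤ :=
    riemannianEDist_triangle.trans_lt (ENNReal.add_lt_top.2 ⟨hy, h.trans ENNReal.one_lt_top⟩)
  have hS : S = univ := by
    refine IsClopen.eq_univ ⟨⟨?_⟩, hopen _ hstep⟩ ⟨y₀, ?_⟩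
    · refine hopen (fun y => ¬ riemannianEDist 𝓘(ℝ, E) y₀ y < ⊤) fun y z h hy hz => hy ?_
      rw [riemannianEDist_comm] at h
      exact hstep z y h hz
    · change riemannianEDist 𝓘(ℝ, E) y₀ y₀ < ⊤
      rw [riemannianEDist_self]
      exact ENNReal.zero_lt_top
  obtain ⟨D, hD, h⟩ : ∃ D : ℝ≥0∞, D ≠ ⊤ ∧
      ∀ y ∈ (univ : Set N), riemannianEDist 𝓘(ℝ, E) y₀ y ≤ D := by
    refine isCompact_univ.induction_on
      (p := fun s : Set N => ∃ D : ℝ≥0∞, D ≠ ⊤ ∧ ∀ y ∈ s, riemannianEDist 𝓘(ℝ, E) y₀ y ≤ D)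
      ⟨0, by simp, by simp⟩ ?_ ?_ ?_
    · rintro s t hst ⟨D, hD, h⟩
      exact ⟨D, hD, fun y hy => h y (hst hy)⟩
    · rintro s t ⟨D, hD, h⟩ ⟨D', hD', h'⟩
      refine ⟨max D D', by simp [hD, hD'], ?_⟩
      rintro y (hy | hy)
      · exact (h y hy).trans (le_max_left _ _)
      · exact (h' y hy).trans (le_max_right _ _)
    · intro y _
      refine ⟨_, nhdsWithin_le_nhds (eventually_riemannianEDist_lt 𝓘(ℝ, E) y one_pos),
        riemannianEDist 𝓘(ℝ, E) y₀ y + 1, ?_, fun z hz => ?_⟩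
      · have : y ∈ S := hS ▸ mem_univ y
        exact ENNReal.add_ne_top.2 ⟨this.ne, ENNReal.one_ne_top⟩
      · exact riemannianEDist_triangle.trans (add_le_add_right (le_of_lt hz) _)
  refine ⟨D + D, ENNReal.add_ne_top.2 ⟨hD, hD⟩, fun y y' => ?_⟩
  refine (riemannianEDist_triangle (y := y₀)).trans (add_le_add ?_ (h y' (mem_univ _)))
  rw [riemannianEDist_comm]
  exact h y (mem_univ _)

/-- In a trivialization at `y₀` the family is a continuous map into a fixed space of bilinear forms,
hence locally bounded; the trivialization itself is locally bounded for the bundle norm. Working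
within `univ ×ˢ Ici 0` includes `r₀ = 0`. -/
theorem MetricFamily.eventually_inner_le (g : MetricFamily E N)
    [RiemannianBundle (fun y : N => TangentSpace 𝓘(ℝ, E) y)]
    [IsContinuousRiemannianBundle E (fun y : N => TangentSpace 𝓘(ℝ, E) y)]
    (y₀ : N) {r₀ : ℝ} (hr₀ : 0 ≤ r₀) :
    ∃ C : ℝ, ∀ᶠ p in 𝓝[univ ×ˢ Ici 0] ((y₀, r₀) : N × ℝ),
      ∀ v : TangentSpace 𝓘(ℝ, E) p.1, g.inner p.2 p.1 v v ≤ C * ‖v‖ ^ 2 := by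
  let T := fun y : N => TangentSpace 𝓘(ℝ, E) y
  let e := trivializationAt E T y₀
  have hy₀ : y₀ ∈ e.baseSet := FiberBundle.mem_baseSet_trivializationAt' y₀
  let G : N × ℝ → E →L[ℝ] E →L[ℝ] ℝ := fun p =>
    ContinuousLinearMap.inCoordinates E T (E →L[ℝ] ℝ) (fun y => T y →L[ℝ] ℝ) y₀ p.1 y₀ p.1
      (g.inner p.2 p.1)
  have hG : ContinuousWithinAt G (univ ×ˢ Ici 0) (y₀, r₀) := by
    have W := g.smooth.continuousOn (y₀, r₀) ⟨mem_univ _, hr₀⟩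
    rw [continuousWithinAt_hom_bundle] at W
    exact W.2
  obtain ⟨C, C_pos, hC⟩ := eventually_norm_trivializationAt_lt E T y₀
  have hfst : Tendsto Prod.fst (𝓝[univ ×ˢ Ici 0] ((y₀, r₀) : N × ℝ)) (𝓝 y₀) :=
    continuous_fst.continuousWithinAt
  have hbd : ∀ᶠ p in 𝓝[univ ×ˢ Ici 0] ((y₀, r₀) : N × ℝ), ‖G p‖ < ‖G (y₀, r₀)‖ + 1 :=
    eventually_norm_lt_add_one hG
  refine ⟨(‖G (y₀, r₀)‖ + 1) * C ^ 2, ?_⟩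
  filter_upwards [hbd, hfst.eventually hC, hfst.eventually (e.open_baseSet.mem_nhds hy₀)]
    with p hp hCp hep v
  let w : E := e.continuousLinearMapAt ℝ p.1 v
  have hw : ‖w‖ ≤ C * ‖v‖ := (e.continuousLinearMapAt ℝ p.1).le_of_opNorm_le hCp.le v
  have hgw : g.inner p.2 p.1 v v = G p w w := by
    have h := inCoordinates_apply_eq₂ (F₁ := E) (F₂ := E) (F₃ := ℝ) (E₁ := T) (E₂ := T)
      (E₃ := Bundle.Trivial N ℝ) (x₀ := y₀) (ϕ := g.inner p.2 p.1) (v := w) (w := w)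
      hep hep (mem_univ _)
    have A : e.symm p.1 w = v := by
      have hw : w = (e ⟨p.1, v⟩).2 := by
        simp only [w, Trivialization.continuousLinearMapAt_apply,
          Trivialization.linearMapAt_apply]
        exact if_pos hep
      rw [hw]
      exact e.symm_apply_apply_mk hep v
    rw [A] at h
    exact (h.trans (by simp)).symm
  calc g.inner p.2 p.1 v v = G p w w := hgw
    _ ≤ ‖G p w w‖ := Real.le_norm_self _
    _ ≤ ‖G p‖ * ‖w‖ * ‖w‖ := (G p).le_opNorm₂ w w
    _ ≤ (‖G (y₀, r₀)‖ + 1) * (C * ‖v‖) * (C * ‖v‖) := by gcongr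
    _ = _ := by ring

theorem MetricFamily.exists_inner_le [CompactSpace N] (g : MetricFamily E N)
    [RiemannianBundle (fun y : N => TangentSpace 𝓘(ℝ, E) y)]
    [IsContinuousRiemannianBundle E (fun y : N => TangentSpace 𝓘(ℝ, E) y)] (a : ℝ) :
    ∃ C : ℝ, ∀ r ∈ Icc 0 a, ∀ (y : N) (v : TangentSpace 𝓘(ℝ, E) y),
      g.inner r y v v ≤ C * ‖v‖ ^ 2 := by
  have hK : IsCompact ((univ : Set N) ×ˢ Icc (0 : ℝ) a) := isCompact_univ.prod isCompact_Icc
  obtain ⟨C, hC⟩ : ∃ C : ℝ, ∀ p ∈ (univ : Set N) ×ˢ Icc (0 : ℝ) a,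
      ∀ v : TangentSpace 𝓘(ℝ, E) p.1, g.inner p.2 p.1 v v ≤ C * ‖v‖ ^ 2 := by
    refine hK.induction_on (p := fun s : Set (N × ℝ) => ∃ C : ℝ, ∀ p ∈ s,
      ∀ v : TangentSpace 𝓘(ℝ, E) p.1, g.inner p.2 p.1 v v ≤ C * ‖v‖ ^ 2) ⟨0, by simp⟩ ?_ ?_ ?_
    · rintro s t hst ⟨C, h⟩
      exact ⟨C, fun p hp => h p (hst hp)⟩
    · rintro s t ⟨C, h⟩ ⟨C', h'⟩
      refine ⟨max C C', ?_⟩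
      rintro p (hp | hp) v
      · exact (h p hp v).trans (by gcongr; exact le_max_left _ _)
      · exact (h' p hp v).trans (by gcongr; exact le_max_right _ _)
    · rintro ⟨y, r⟩ hp
      obtain ⟨C, hC⟩ := g.eventually_inner_le y hp.2.1
      exact ⟨_, nhdsWithin_mono _ (prod_mono_right Icc_subset_Ici_self) hC, C, fun p hp => hp⟩
  exact ⟨C, fun r hr y v => hC (y, r) ⟨mem_univ _, hr⟩ v⟩

/-- The constant is the minimum of `b` on the compact unit sphere; the sphere is empty when `E = 0`.
-/
theorem exists_mul_norm_sq_le_of_pos [FiniteDimensional ℝ E] (b : E →L[ℝ] E →L[ℝ] ℝ)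
    (hb : ∀ v, v ≠ 0 → 0 < b v v) : ∃ m : ℝ, 0 < m ∧ ∀ v, m * ‖v‖ ^ 2 ≤ b v v := by
  have hcont : Continuous fun v : E => b v v := b.continuous.clm_apply continuous_id
  rcases (Metric.sphere (0 : E) 1).eq_empty_or_nonempty with hS | hS
  · refine ⟨1, one_pos, fun v => ?_⟩
    have hv : v = 0 := by
      by_contra hv
      have : ‖v‖⁻¹ • v ∈ Metric.sphere (0 : E) 1 := by
        simp [norm_smul, inv_mul_cancel₀ (norm_ne_zero_iff.2 hv)]
      simp [hS] at this
    simp [hv]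
  · obtain ⟨u, hu, hmin⟩ := (isCompact_sphere (0 : E) 1).exists_isMinOn hS hcont.continuousOn
    refine ⟨b u u, hb u (ne_zero_of_mem_unit_sphere ⟨u, hu⟩), fun v => ?_⟩
    rcases eq_or_ne v 0 with rfl | hv
    · simp
    have hv' : ‖v‖ ≠ 0 := norm_ne_zero_iff.2 hv
    have h : b u u ≤ b (‖v‖⁻¹ • v) (‖v‖⁻¹ • v) :=
      hmin (by simp [norm_smul, inv_mul_cancel₀ hv'] : ‖v‖⁻¹ • v ∈ Metric.sphere (0 : E) 1)
    simp only [map_smul, smul_apply, smul_eq_mul] at h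
    calc b u u * ‖v‖ ^ 2 ≤ ‖v‖⁻¹ * (‖v‖⁻¹ * b v v) * ‖v‖ ^ 2 := by gcongr
      _ = b v v := by field_simp

theorem isVonNBounded_of_pos [FiniteDimensional ℝ E] (b : E →L[ℝ] E →L[ℝ] ℝ)
    (hb : ∀ v, v ≠ 0 → 0 < b v v) : Bornology.IsVonNBounded ℝ {v : E | b v v < 1} := by
  obtain ⟨m, hm, h⟩ := exists_mul_norm_sq_le_of_pos b hb
  rw [NormedSpace.isVonNBounded_iff, isBounded_iff_forall_norm_le]
  refine ⟨√(1 / m), fun v hv => Real.le_sqrt_of_sq_le ?_⟩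
  rw [le_div_iff₀' hm]
  exact (h v).trans (le_of_lt hv)

/-- The Riemannian metric `g(r)` on `N`. -/
def MetricFamily.riemannianMetric [FiniteDimensional ℝ E] (g : MetricFamily E N) {r : ℝ}
    (hr : 0 ≤ r) : ContMDiffRiemannianMetric 𝓘(ℝ, E) ∞ E (fun y : N => TangentSpace 𝓘(ℝ, E) y) where
  inner := g.inner r
  symm := g.symm r hr
  pos := g.pos r hr
  isVonNBounded y := isVonNBounded_of_pos (E := E) (g.inner r y) (g.pos r hr y)
  contMDiff := by
    have h : ContMDiff 𝓘(ℝ, E) (𝓘(ℝ, E).prod 𝓘(ℝ, ℝ)) ∞ (fun y : N => (y, r)) :=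
      contMDiff_id.prodMk contMDiff_const
    rw [← contMDiffOn_univ] at h ⊢
    exact g.smooth.comp h fun y _ => ⟨mem_univ _, hr⟩

/-- Over a compact connected base, all the metrics of a family smooth over `[0, ∞]` are dominated
by a single tensor field of finite diameter. -/
theorem MetricFamily.exists_dominating [FiniteDimensional ℝ E] [CompactSpace N] [ConnectedSpace N]
    (g k : MetricFamily E N)
    (hglue : ∀ r : ℝ, 0 < r → ∀ y : N, k.inner (1 / r) y = g.inner r y) :
    ∃ (h : TensorField 𝓘(ℝ, E) N) (C D : ℝ), 0 ≤ C ∧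
      (∀ y y', h.edist y y' < ENNReal.ofReal D) ∧
      (∀ (y : N) (v : TangentSpace 𝓘(ℝ, E) y), 0 ≤ h y v v) ∧
      ∀ r : ℝ, 0 < r → ∀ (y : N) (v : TangentSpace 𝓘(ℝ, E) y),
        g.inner r y v v ≤ C ^ 2 * h y v v := by
  let m := (g.riemannianMetric zero_le_one).toContinuousRiemannianMetric
  let : RiemannianBundle (fun y : N => TangentSpace 𝓘(ℝ, E) y) := ⟨m.toRiemannianMetric⟩
  have hnorm (y : N) (v : TangentSpace 𝓘(ℝ, E) y) : ‖v‖ ^ 2 = g.inner 1 y v v :=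
    (real_inner_self_eq_norm_sq v).symm
  obtain ⟨D, hD, hdist⟩ := exists_riemannianEDist_le (E := E) (N := N)
  obtain ⟨C₁, h₁⟩ := g.exists_inner_le 1
  obtain ⟨C₂, h₂⟩ := k.exists_inner_le 1
  -- The square root matches the `C ^ 2` of the conclusion, `max 0` makes it meaningful, and `+ 1`
  -- makes the diameter bound strict.
  refine ⟨g.inner 1, √(max 0 (max C₁ C₂)), D.toReal + 1, Real.sqrt_nonneg _, fun y y' => ?_,
    fun y v => hnorm y v ▸ sq_nonneg _, fun r hr y v => ?_⟩
  · have h : TensorField.edist (g.inner 1 : TensorField 𝓘(ℝ, E) N) y y' ≤ D := by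
      refine le_trans (le_of_eq ?_) (hdist y y')
      unfold TensorField.edist
      congr! with y v
      rw [← hnorm, Real.sqrt_sq (norm_nonneg v), ofReal_norm]
    refine h.trans_lt ?_
    rw [ENNReal.ofReal_add ENNReal.toReal_nonneg zero_le_one, ENNReal.ofReal_toReal hD]
    exact ENNReal.lt_add_right hD (by simp)
  · rw [Real.sq_sqrt (le_max_left _ _), ← hnorm]
    -- The range `(0, ∞)` is covered by two compact pieces: `r ∈ [0, 1]`, seen by `g`, and `1 / r ∈
    -- [0, 1]`, seen by `k`.
    rcases le_total r 1 with h | h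
    · exact (h₁ r ⟨hr.le, h⟩ y v).trans (by gcongr; simp)
    · rw [← hglue r hr]
      exact (h₂ (1 / r) ⟨by positivity, (div_le_one hr).2 h⟩ y v).trans (by gcongr; simp)

end Compact

/-! ### Calculus on the half-line and the cylinder. -/

section HalfLine

theorem halfLine_pos (r : HalfLine) : 0 < (r : ℝ) := r.2

/-- The charts of an open subset are restrictions, so the inclusion reads as the identity near `r`.
-/
theorem hasMFDerivAt_halfLine_val (r : HalfLine) :
    HasMFDerivAt 𝓘(ℝ, ℝ) 𝓘(ℝ, ℝ) (Subtype.val : HalfLine → ℝ) r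
      (ContinuousLinearMap.id ℝ ℝ : ℝ →L[ℝ] ℝ) := by
  refine ⟨continuous_subtype_val.continuousAt, ?_⟩
  have h : HasFDerivAt (writtenInExtChartAt 𝓘(ℝ, ℝ) 𝓘(ℝ, ℝ) r (Subtype.val : HalfLine → ℝ))
      (ContinuousLinearMap.id ℝ ℝ) (r : ℝ) :=
    (hasFDerivAt_id (𝕜 := ℝ) (r : ℝ)).congr_of_eventuallyEq
      (TopologicalSpace.Opens.chartAt_subtype_val_symm_eventuallyEq HalfLine (x := r)).symm
  exact h.hasFDerivWithinAt

theorem contMDiffOn_halfLine {E : Type*} [NormedAddCommGroup E] [NormedSpace ℝ E]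
    {H : Type*} [TopologicalSpace H] {I : ModelWithCorners ℝ E H}
    {M : Type*} [TopologicalSpace M] [ChartedSpace H M] {n : ℕ∞ω} {f : M → HalfLine} {s : Set M}
    (hf : ContMDiffOn I 𝓘(ℝ, ℝ) n (fun x => (f x : ℝ)) s) : ContMDiffOn I 𝓘(ℝ, ℝ) n f s :=
  fun x hx => (ChartedSpace.liftPropWithinAt_subtypeVal_comp_iff f s x).1 (hf x hx)

end HalfLine

section Cylinder

variable {E : Type*} [NormedAddCommGroup E] [NormedSpace ℝ E]
  {N : Type*} [TopologicalSpace N] [ChartedSpace E N]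

theorem contMDiff_radius {n : ℕ∞ω} :
    ContMDiff (𝓘(ℝ, E).prod 𝓘(ℝ, ℝ)) 𝓘(ℝ, ℝ) n (fun p : OpenCylinder N => (p.2 : ℝ)) :=
  contMDiff_subtype_val.comp contMDiff_snd

theorem hasMFDerivAt_radius (p : OpenCylinder N) :
    HasMFDerivAt (𝓘(ℝ, E).prod 𝓘(ℝ, ℝ)) 𝓘(ℝ, ℝ) (fun p : OpenCylinder N => (p.2 : ℝ)) p
      (ContinuousLinearMap.snd ℝ E ℝ) :=
  (hasMFDerivAt_halfLine_val p.2).comp p (hasMFDerivAt_snd p)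

theorem contMDiff_inversion {n : ℕ∞ω} :
    ContMDiff (𝓘(ℝ, E).prod 𝓘(ℝ, ℝ)) (𝓘(ℝ, E).prod 𝓘(ℝ, ℝ)) n
      (inversion : OpenCylinder N → OpenCylinder N) := by
  refine contMDiff_fst.prodMk (contMDiffOn_univ.1 (contMDiffOn_halfLine ?_))
  have hinv : ContDiffOn ℝ n (fun r : ℝ => 1 / r) (Ioi 0) :=
    contDiffOn_const.div contDiffOn_id fun r hr => (mem_Ioi.1 hr).ne'
  exact (hinv.contMDiffOn.comp_contMDiff contMDiff_radius fun p => p.2.2).contMDiffOn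

theorem inversion_involutive {N : Type*} :
    Function.Involutive (inversion : OpenCylinder N → OpenCylinder N) := by
  rintro ⟨y, r⟩
  simp [inversion]

/-- Uniqueness of the derivative of `Prod.fst ∘ inversion` gives this component without writing
`inversion` in charts. -/
theorem mfderiv_inversion_fst (p : OpenCylinder N) (w : E × ℝ) :
    (mfderiv (𝓘(ℝ, E).prod 𝓘(ℝ, ℝ)) (𝓘(ℝ, E).prod 𝓘(ℝ, ℝ)) inversion p w : E × ℝ).1 = w.1 := by
  have hd : MDifferentiableAt (𝓘(ℝ, E).prod 𝓘(ℝ, ℝ)) (𝓘(ℝ, E).prod 𝓘(ℝ, ℝ)) inversion p :=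
    (contMDiff_inversion (n := 1) p).mdifferentiableAt one_ne_zero
  have h := (hasMFDerivAt_fst (I := 𝓘(ℝ, E)) (I' := 𝓘(ℝ, ℝ)) (inversion p)).comp p hd.hasMFDerivAt
  exact congr($(hasMFDerivAt_unique h (hasMFDerivAt_fst p)) w)

theorem mfderiv_inversion_snd (p : OpenCylinder N) (w : E × ℝ) :
    (mfderiv (𝓘(ℝ, E).prod 𝓘(ℝ, ℝ)) (𝓘(ℝ, E).prod 𝓘(ℝ, ℝ)) inversion p w : E × ℝ).2 =
      -w.2 / (p.2 : ℝ) ^ 2 := by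
  have hd : MDifferentiableAt (𝓘(ℝ, E).prod 𝓘(ℝ, ℝ)) (𝓘(ℝ, E).prod 𝓘(ℝ, ℝ)) inversion p :=
    (contMDiff_inversion (n := 1) p).mdifferentiableAt one_ne_zero
  have h := (hasMFDerivAt_radius (E := E) (inversion p)).comp p hd.hasMFDerivAt
  have hinv : HasFDerivAt (fun r : ℝ => 1 / r) _ (p.2 : ℝ) :=
    (by simpa using hasDerivAt_inv (halfLine_pos p.2).ne' :
      HasDerivAt (fun r : ℝ => 1 / r) (-((p.2 : ℝ) ^ 2)⁻¹) (p.2 : ℝ)).hasFDerivAt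
  have h' := hinv.hasMFDerivAt.comp p (hasMFDerivAt_radius (E := E) p)
  have key := congr($(hasMFDerivAt_unique h h') w)
  refine key.trans ?_
  change w.2 * -((p.2 : ℝ) ^ 2)⁻¹ = _
  ring

theorem mfderiv_curve_fst {γ : ℝ → OpenCylinder N} {t : ℝ}
    (hγ : MDifferentiableAt 𝓘(ℝ, ℝ) (𝓘(ℝ, E).prod 𝓘(ℝ, ℝ)) γ t) :
    (mfderiv 𝓘(ℝ, ℝ) (𝓘(ℝ, E).prod 𝓘(ℝ, ℝ)) γ t (1 : ℝ) : E × ℝ).1 =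
      mfderiv 𝓘(ℝ, ℝ) 𝓘(ℝ, E) (fun t => (γ t).1) t (1 : ℝ) := by
  have h := (hasMFDerivAt_fst (I := 𝓘(ℝ, E)) (I' := 𝓘(ℝ, ℝ)) (γ t)).comp t hγ.hasMFDerivAt
  exact congr($(h.mfderiv) (1 : ℝ)).symm

theorem hasDerivAt_radius_curve {γ : ℝ → OpenCylinder N} {t : ℝ}
    (hγ : MDifferentiableAt 𝓘(ℝ, ℝ) (𝓘(ℝ, E).prod 𝓘(ℝ, ℝ)) γ t) :
    HasDerivAt (fun t => ((γ t).2 : ℝ))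
      (mfderiv 𝓘(ℝ, ℝ) (𝓘(ℝ, E).prod 𝓘(ℝ, ℝ)) γ t (1 : ℝ) : E × ℝ).2 t := by
  have h := (hasMFDerivAt_radius (E := E) (γ t)).comp t hγ.hasMFDerivAt
  have h' : HasFDerivAt (fun t => ((γ t).2 : ℝ)) ((ContinuousLinearMap.snd ℝ E ℝ).comp
      (mfderiv 𝓘(ℝ, ℝ) (𝓘(ℝ, E).prod 𝓘(ℝ, ℝ)) γ t : ℝ →L[ℝ] E × ℝ)) t :=
    hasMFDerivAt_iff_hasFDerivAt.1 h
  exact h'.hasDerivAt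

end Cylinder

/-! ### Comparison of the two conic distances. -/

section Comparison

variable {E : Type*} [NormedAddCommGroup E] [NormedSpace ℝ E]
  {N : Type*} [TopologicalSpace N] [ChartedSpace E N] [IsManifold 𝓘(ℝ, E) ∞ N]

theorem MetricFamily.inner_self_nonneg (g : MetricFamily E N) {r : ℝ} (hr : 0 ≤ r) (y : N)
    (v : TangentSpace 𝓘(ℝ, E) y) : 0 ≤ g.inner r y v v := by
  rcases eq_or_ne v 0 with rfl | hv
  · simp
  · exact (g.pos r hr y v hv).le

theorem MetricFamily.modelConic_self (g : MetricFamily E N) (p : OpenCylinder N) (w : E × ℝ) :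
    g.modelConic p w w = w.2 ^ 2 + (p.2 : ℝ) ^ 2 * g.inner p.2 p.1 w.1 w.1 := by
  rw [sq]
  exact g.modelConic_apply p w.1 w.1 w.2 w.2

theorem MetricFamily.speed_modelConic (g : MetricFamily E N) (p : OpenCylinder N) (w : E × ℝ) :
    g.modelConic.speed p w =
      ENNReal.ofReal √(w.2 ^ 2 + (p.2 : ℝ) ^ 2 * g.inner p.2 p.1 w.1 w.1) :=
  congr(ENNReal.ofReal √$(g.modelConic_self p w))

theorem MetricFamily.enorm_snd_le_speed (g : MetricFamily E N) (p : OpenCylinder N) (w : E × ℝ) :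
    ‖w.2‖ₑ ≤ g.modelConic.speed p w := by
  rw [g.speed_modelConic, Real.enorm_eq_ofReal_abs, ← Real.sqrt_sq_eq_abs]
  refine ENNReal.ofReal_le_ofReal (Real.sqrt_le_sqrt ?_)
  have := g.inner_self_nonneg (halfLine_pos p.2).le p.1 w.1
  nlinarith [mul_nonneg (sq_nonneg (p.2 : ℝ)) this]

/-- The pullback of `dR² + R² ĝ(R)` under the inversion is `r⁻⁴ (dr² + r² g(r))`. -/
theorem MetricFamily.speed_pullback_inversion (g k : MetricFamily E N)
    (hglue : ∀ r : ℝ, 0 < r → ∀ y : N, k.inner (1 / r) y = g.inner r y)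
    (p : OpenCylinder N) (w : E × ℝ) :
    (k.modelConic.pullback inversion :
      TensorField (𝓘(ℝ, E).prod 𝓘(ℝ, ℝ)) (OpenCylinder N)).speed p w =
      ENNReal.ofReal (1 / (p.2 : ℝ) ^ 2) * g.modelConic.speed p w := by
  have hp := halfLine_pos p.2
  have hk : k.inner (inversion p).2 (inversion p).1 = g.inner p.2 p.1 := hglue p.2 hp p.1
  have h1 := mfderiv_inversion_fst p w
  have h2 := mfderiv_inversion_snd p w
  have hr : ((inversion p).2 : ℝ) = 1 / (p.2 : ℝ) := rfl
  refine (k.speed_modelConic (inversion p)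
    (mfderiv (𝓘(ℝ, E).prod 𝓘(ℝ, ℝ)) (𝓘(ℝ, E).prod 𝓘(ℝ, ℝ)) inversion p w : E × ℝ)).trans ?_
  rw [h1, h2, hk, hr, g.speed_modelConic, ← ENNReal.ofReal_mul (by positivity)]
  congr 1
  rw [← Real.sqrt_sq (show 0 ≤ 1 / (p.2 : ℝ) ^ 2 by positivity), ← Real.sqrt_mul (by positivity)]
  congr 1
  have halg (r a b : ℝ) (hr : 0 < r) :
      (-a / r ^ 2) ^ 2 + (1 / r) ^ 2 * b = (1 / r ^ 2) ^ 2 * (a ^ 2 + r ^ 2 * b) := by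
    field_simp
  exact halg _ _ _ hp

/-- Since `dr²` is at most the conic metric, length dominates the variation of the radius. -/
theorem MetricFamily.enorm_radius_sub_le_length (g : MetricFamily E N) {γ : ℝ → OpenCylinder N}
    (hγ : ContMDiffOn 𝓘(ℝ, ℝ) (𝓘(ℝ, E).prod 𝓘(ℝ, ℝ)) 1 γ (Icc 0 1)) {t : ℝ}
    (ht : t ∈ Icc (0 : ℝ) 1) :
    ‖((γ 1).2 : ℝ) - ((γ t).2 : ℝ)‖ₑ ≤ g.modelConic.length γ := by
  have hsub : Icc t 1 ⊆ Icc 0 1 := Icc_subset_Icc_left ht.1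
  have hC : ContDiffOn ℝ 1 (fun t => ((γ t).2 : ℝ)) (Icc t 1) :=
    ((contMDiff_radius.comp_contMDiffOn hγ).contDiffOn).mono hsub
  refine (enorm_sub_le_lintegral_derivWithin_Icc_of_contDiffOn_Icc hC ht.2).trans ?_
  rw [← restrict_Ioo_eq_restrict_Icc]
  have hIoo : Ioo t 1 ⊆ Ioo 0 1 := Ioo_subset_Ioo_left ht.1
  refine le_trans (setLIntegral_mono' measurableSet_Ioo fun s hs => ?_) (lintegral_mono_set hIoo)
  have hd := hasDerivAt_radius_curve (mdifferentiableAt_of_mem_Ioo hγ (hIoo hs))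
  rw [derivWithin_of_mem_nhds (Icc_mem_nhds hs.1 hs.2), hd.deriv]
  exact g.enorm_snd_le_speed _ _

/-- From `√(a² + b²) ≤ |a| + |b|`: the radial and tangential costs separate. -/
theorem MetricFamily.speed_modelConic_le (k : MetricFamily E N) {h : TensorField 𝓘(ℝ, E) N} {C : ℝ}
    (hC : 0 ≤ C) (hpos : ∀ (y : N) (v : TangentSpace 𝓘(ℝ, E) y), 0 ≤ h y v v)
    (hk : ∀ r : ℝ, 0 < r → ∀ (y : N) (v : TangentSpace 𝓘(ℝ, E) y),
      k.inner r y v v ≤ C ^ 2 * h y v v)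
    (p : OpenCylinder N) (w : E × ℝ) :
    k.modelConic.speed p w ≤
      ENNReal.ofReal |w.2| + ENNReal.ofReal ((p.2 : ℝ) * C) * h.speed p.1 w.1 := by
  have hp := halfLine_pos p.2
  have hs : h.speed p.1 w.1 = ENNReal.ofReal √(h p.1 w.1 w.1) := rfl
  rw [hs, k.speed_modelConic, ← ENNReal.ofReal_mul (by positivity),
    ← ENNReal.ofReal_add (by positivity) (by positivity)]
  refine ENNReal.ofReal_le_ofReal (Real.sqrt_le_iff.2 ⟨by positivity, ?_⟩)
  have h1 := mul_le_mul_of_nonneg_left (hk p.2 hp p.1 w.1) (sq_nonneg (p.2 : ℝ))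
  have h2 := Real.sq_sqrt (hpos p.1 w.1)
  have h3 : 0 ≤ |w.2| * ((p.2 : ℝ) * C * √(h p.1 w.1 w.1)) := by positivity
  have h4 : (|w.2| + (p.2 : ℝ) * C * √(h p.1 w.1 w.1)) ^ 2 =
      w.2 ^ 2 + 2 * (|w.2| * ((p.2 : ℝ) * C * √(h p.1 w.1 w.1))) +
        (p.2 : ℝ) ^ 2 * (C ^ 2 * √(h p.1 w.1 w.1) ^ 2) := by
    rw [← sq_abs w.2]; ring
  rw [h4, h2]
  linarith

/-- The distance of two points of a cone is bounded by the larger of their radii. -/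
theorem MetricFamily.edist_modelConic_le (k : MetricFamily E N) {h : TensorField 𝓘(ℝ, E) N}
    {C D : ℝ} (hC : 0 ≤ C) (hD : 0 ≤ D) (hdist : ∀ y y', h.edist y y' < ENNReal.ofReal D)
    (hpos : ∀ (y : N) (v : TangentSpace 𝓘(ℝ, E) y), 0 ≤ h y v v)
    (hk : ∀ r : ℝ, 0 < r → ∀ (y : N) (v : TangentSpace 𝓘(ℝ, E) y),
      k.inner r y v v ≤ C ^ 2 * h y v v)
    {p q : OpenCylinder N} (hpq : (q.2 : ℝ) ≤ p.2) :
    k.modelConic.edist p q ≤ ENNReal.ofReal ((2 + C * D) * (p.2 : ℝ)) := by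
  have hp := halfLine_pos p.2
  have hq := halfLine_pos q.2
  obtain ⟨γ, h0, h1, hγ, hlen⟩ := h.exists_length_lt (hdist p.1 q.1)
  -- Curves are defined on all of `ℝ`, where an affine interpolation of distinct radii would leave
  -- the half-line. This quadratic stays positive, decreases from `p.2` to `q.2` on `[0, 1]`, and
  -- has `|ρ'| ≤ 2 * p.2` there, whence the `2` in the bound.
  let ρ : ℝ → ℝ := fun t => q.2 + (p.2 - q.2) * (1 - t) ^ 2
  have hρ0 (t : ℝ) : 0 < ρ t :=
    add_pos_of_pos_of_nonneg hq (mul_nonneg (sub_nonneg.2 hpq) (sq_nonneg _))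
  have hρd (t : ℝ) : HasDerivAt ρ ((p.2 - q.2) * (2 * (1 - t) * (-1))) t := by
    have := ((((hasDerivAt_id t).const_sub 1).pow 2).const_mul ((p.2 : ℝ) - q.2)).const_add (q.2 : ℝ)
    simpa [ρ] using this
  have hρs : ContDiff ℝ 1 ρ := by fun_prop
  let c : ℝ → OpenCylinder N := fun t => (γ t, ⟨ρ t, hρ0 t⟩)
  have hc : ContMDiffOn 𝓘(ℝ, ℝ) (𝓘(ℝ, E).prod 𝓘(ℝ, ℝ)) 1 c (Icc 0 1) :=
    hγ.prodMk (contMDiffOn_halfLine hρs.contMDiff.contMDiffOn)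
  have hc0 : c 0 = p := Prod.ext h0 (Subtype.ext (by simp [c, ρ]))
  have hc1 : c 1 = q := Prod.ext h1 (Subtype.ext (by simp [c, ρ]))
  refine (k.modelConic.edist_le_length hc hc0 hc1).trans ?_
  calc k.modelConic.length c
      ≤ ∫⁻ t in Ioo (0 : ℝ) 1, (ENNReal.ofReal (2 * p.2) + ENNReal.ofReal ((p.2 : ℝ) * C) *
          h.speed (γ t) (mfderiv 𝓘(ℝ, ℝ) 𝓘(ℝ, E) γ t (1 : ℝ))) := by
        refine setLIntegral_mono' measurableSet_Ioo fun t ht => ?_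
        have hd := mdifferentiableAt_of_mem_Ioo hc ht
        refine (k.speed_modelConic_le hC hpos hk (c t) _).trans ?_
        rw [mfderiv_curve_fst hd, (hasDerivAt_radius_curve hd).unique (hρd t)]
        have hsq : (1 - t) ^ 2 ≤ 1 := by nlinarith [ht.1, ht.2]
        refine add_le_add (ENNReal.ofReal_le_ofReal ?_)
          (mul_le_mul_left (ENNReal.ofReal_le_ofReal (mul_le_mul_of_nonneg_right ?_ hC)) _)
        · rw [abs_le]
          constructor <;> nlinarith [ht.1, ht.2]
        · change q.2 + (p.2 - q.2) * (1 - t) ^ 2 ≤ (p.2 : ℝ)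
          nlinarith
    _ = ENNReal.ofReal (2 * p.2) + ENNReal.ofReal ((p.2 : ℝ) * C) * h.length γ := by
        rw [lintegral_add_left measurable_const, lintegral_const_mul' _ _ ENNReal.ofReal_ne_top]
        simp [TensorField.length]
    _ ≤ ENNReal.ofReal (2 * p.2) + ENNReal.ofReal ((p.2 : ℝ) * C) * ENNReal.ofReal D := by gcongr
    _ = ENNReal.ofReal ((2 + C * D) * (p.2 : ℝ)) := by
        rw [← ENNReal.ofReal_mul (by positivity), ← ENNReal.ofReal_add (by positivity) (by positivity)]
        congr 1; ring

/-- Curves of length at most half the final radius stay away from the apex, where the inversion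
distorts lengths in a controlled way. -/
theorem MetricFamily.mul_edist_inversion_le_of_length_le (g k : MetricFamily E N)
    (hglue : ∀ r : ℝ, 0 < r → ∀ y : N, k.inner (1 / r) y = g.inner r y)
    {x x' : OpenCylinder N} (hx : (x.2 : ℝ) ≤ x'.2) {γ : ℝ → OpenCylinder N}
    (hγ : ContMDiffOn 𝓘(ℝ, ℝ) (𝓘(ℝ, E).prod 𝓘(ℝ, ℝ)) 1 γ (Icc 0 1)) (h0 : γ 0 = x) (h1 : γ 1 = x')
    (hlen : g.modelConic.length γ ≤ ENNReal.ofReal ((x'.2 : ℝ) / 2)) :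
    ENNReal.ofReal ((x.2 : ℝ) * x'.2) * k.modelConic.edist (inversion x) (inversion x') ≤
      ENNReal.ofReal 4 * g.modelConic.length γ := by
  have hr := halfLine_pos x.2
  have hr' := halfLine_pos x'.2
  have hrad (t : ℝ) (ht : t ∈ Icc (0 : ℝ) 1) : (x'.2 : ℝ) / 2 ≤ (γ t).2 := by
    have h := (g.enorm_radius_sub_le_length hγ ht).trans hlen
    rw [Real.enorm_eq_ofReal_abs, ENNReal.ofReal_le_ofReal_iff (by positivity), h1] at h
    linarith [(abs_le.1 h).2]
  have hle : k.modelConic.edist (inversion x) (inversion x') ≤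
      ENNReal.ofReal (4 / (x'.2 : ℝ) ^ 2) * g.modelConic.length γ := by
    refine (TensorField.edist_map_le _ contMDiff_inversion x x').trans
      ((TensorField.edist_le_length _ hγ h0 h1).trans ?_)
    rw [TensorField.length, TensorField.length, ← lintegral_const_mul' _ _ ENNReal.ofReal_ne_top]
    refine setLIntegral_mono' measurableSet_Ioo fun t ht => ?_
    refine (g.speed_pullback_inversion k hglue (γ t) _).trans_le ?_
    refine mul_le_mul_left (ENNReal.ofReal_le_ofReal ?_) _
    have h := hrad t (Ioo_subset_Icc_self ht)
    rw [div_le_div_iff₀ (by have := halfLine_pos (γ t).2; positivity) (by positivity)]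
    nlinarith
  refine (mul_le_mul_right hle _).trans ?_
  rw [← mul_assoc, ← ENNReal.ofReal_mul (by positivity)]
  refine mul_le_mul_left (ENNReal.ofReal_le_ofReal ?_) _
  -- This is where `x.2 ≤ x'.2` enters: `x.2 * x'.2 * (4 / x'.2 ^ 2) ≤ 4`.
  rw [mul_div_assoc', div_le_iff₀ (by positivity)]
  nlinarith

theorem MetricFamily.exists_mul_edist_inversion_le [FiniteDimensional ℝ E] [CompactSpace N]
    [ConnectedSpace N] (g k : MetricFamily E N)
    (hglue : ∀ r : ℝ, 0 < r → ∀ y : N, k.inner (1 / r) y = g.inner r y) :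
    ∃ B : ℝ, 0 < B ∧ ∀ x x' : OpenCylinder N,
      ENNReal.ofReal ((x.2 : ℝ) * x'.2) * k.modelConic.edist (inversion x) (inversion x') ≤
        ENNReal.ofReal B * g.modelConic.edist x x' := by
  have hglue' (r : ℝ) (hr : 0 < r) (y : N) : g.inner (1 / r) y = k.inner r y := by
    rw [← hglue (1 / r) (by positivity), one_div_one_div]
  obtain ⟨h, C, D, hC, hdist, hpos, hk⟩ := k.exists_dominating g hglue'
  have hD : 0 < D := by
    let y : N := Classical.arbitrary N
    exact ENNReal.ofReal_pos.1 (pos_of_gt (hdist y y))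
  -- The sum of the constants for short curves, `4`, and long curves, `2 * (2 + C * D)`.
  let B : ℝ := 4 + 2 * (2 + C * D)
  have hB : 0 < B := by positivity
  have hcurve {x x' : OpenCylinder N} (hx : (x.2 : ℝ) ≤ x'.2) {γ : ℝ → OpenCylinder N}
      (hγ : ContMDiffOn 𝓘(ℝ, ℝ) (𝓘(ℝ, E).prod 𝓘(ℝ, ℝ)) 1 γ (Icc 0 1)) (h0 : γ 0 = x)
      (h1 : γ 1 = x') :
      ENNReal.ofReal ((x.2 : ℝ) * x'.2) * k.modelConic.edist (inversion x) (inversion x') ≤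
        ENNReal.ofReal B * g.modelConic.length γ := by
    have hr := halfLine_pos x.2
    have hr' := halfLine_pos x'.2
    rcases le_total (g.modelConic.length γ) (ENNReal.ofReal ((x'.2 : ℝ) / 2)) with hlen | hlen
    · refine (g.mul_edist_inversion_le_of_length_le k hglue hx hγ h0 h1 hlen).trans
        (mul_le_mul_left (ENNReal.ofReal_le_ofReal ?_) _)
      exact le_add_of_nonneg_right (by positivity)
    -- Inversion reverses the order of the radii, so `inversion x` is now the farther point from the
    -- apex.
    · refine (mul_le_mul_right (k.edist_modelConic_le hC hD.le hdist hpos hk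
        (p := inversion x) (q := inversion x') (one_div_le_one_div_of_le hr hx)) _).trans ?_
      refine le_trans ?_ (mul_le_mul_right hlen _)
      rw [← ENNReal.ofReal_mul (by positivity), ← ENNReal.ofReal_mul hB.le]
      refine ENNReal.ofReal_le_ofReal ?_
      have : (x.2 : ℝ) * x'.2 * ((2 + C * D) * ((inversion x).2 : ℝ)) = (2 + C * D) * x'.2 := by
        change (x.2 : ℝ) * x'.2 * ((2 + C * D) * (1 / (x.2 : ℝ))) = _
        field_simp
      rw [this]
      simp only [B]
      nlinarith
  have hord {x x' : OpenCylinder N} (hx : (x.2 : ℝ) ≤ x'.2) :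
      ENNReal.ofReal ((x.2 : ℝ) * x'.2) * k.modelConic.edist (inversion x) (inversion x') ≤
        ENNReal.ofReal B * g.modelConic.edist x x' := by
    have hB0 : ENNReal.ofReal B ≠ 0 := (ENNReal.ofReal_pos.2 hB).ne'
    -- With `B` moved to the left, the right side is a bare distance and can be approximated by
    -- lengths of curves.
    rw [mul_comm (ENNReal.ofReal B), ← ENNReal.div_le_iff hB0 ENNReal.ofReal_ne_top]
    refine le_of_forall_gt fun L hL => ?_
    obtain ⟨γ, h0, h1, hγ, hlen⟩ := g.modelConic.exists_length_lt hL
    refine lt_of_le_of_lt ?_ hlen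
    rw [ENNReal.div_le_iff hB0 ENNReal.ofReal_ne_top, mul_comm _ (ENNReal.ofReal B)]
    exact hcurve hx hγ h0 h1
  refine ⟨B, hB, fun x x' => ?_⟩
  rcases le_total (x.2 : ℝ) x'.2 with hx | hx
  · exact hord hx
  · rw [mul_comm (x.2 : ℝ), TensorField.edist_comm k.modelConic, TensorField.edist_comm g.modelConic]
    exact hord hx

end Comparison

end ConicInversion

end

theorem proposition1p13
    {E : Type*} [NormedAddCommGroup E] [NormedSpace ℝ E] [FiniteDimensional ℝ E]
    {N : Type*} [TopologicalSpace N] [ChartedSpace E N] [IsManifold 𝓘(ℝ, E) ∞ N]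
    [T2Space N] [CompactSpace N] [ConnectedSpace N]
    -- a family `g^∂` of metrics on `N` smooth over `[0, ∞]`: `gZero` is `g^∂` in the coordinate
    -- `r ∈ [0, ∞)`, and `gInfty` is `g^∂` in the coordinate `R = 1 / r ∈ [0, ∞)`
    (gZero gInfty : ConicInversion.MetricFamily E N)
    (hglue : ∀ r : ℝ, 0 < r → ∀ y : N, gInfty.inner (1 / r) y = gZero.inner r y) :
    ∃ A B : ℝ, 0 < A ∧ 0 < B ∧ ∀ x x' : ConicInversion.OpenCylinder N,
      ENNReal.ofReal A * gZero.modelConic.edist x x' ≤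
        ENNReal.ofReal ((x.2 : ℝ) * (x'.2 : ℝ)) *
          (gInfty.modelConic.pullback ConicInversion.inversion :
            ConicInversion.TensorField (𝓘(ℝ, E).prod 𝓘(ℝ, ℝ))
              (ConicInversion.OpenCylinder N)).edist x x' ∧
      ENNReal.ofReal ((x.2 : ℝ) * (x'.2 : ℝ)) *
          (gInfty.modelConic.pullback ConicInversion.inversion :
            ConicInversion.TensorField (𝓘(ℝ, E).prod 𝓘(ℝ, ℝ))
              (ConicInversion.OpenCylinder N)).edist x x' ≤
        ENNReal.ofReal B * gZero.modelConic.edist x x' := by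
  have hglue' (r : ℝ) (hr : 0 < r) (y : N) : gZero.inner (1 / r) y = gInfty.inner r y := by
    rw [← hglue (1 / r) (by positivity), one_div_one_div]
  -- The gluing condition is symmetric under `r ↦ 1 / r`, so the same estimate holds with the ends
  -- exchanged.
  obtain ⟨A, hA, hlower⟩ := gInfty.exists_mul_edist_inversion_le gZero hglue'
  obtain ⟨B, hB, hupper⟩ := gZero.exists_mul_edist_inversion_le gInfty hglue
  refine ⟨A⁻¹, B, inv_pos.2 hA, hB, fun x x' => ?_⟩
  have hiso : (gInfty.modelConic.pullback ConicInversion.inversion :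
      ConicInversion.TensorField (𝓘(ℝ, E).prod 𝓘(ℝ, ℝ)) (ConicInversion.OpenCylinder N)).edist x x' =
      gInfty.modelConic.edist (ConicInversion.inversion x) (ConicInversion.inversion x') :=
    gInfty.modelConic.edist_pullback_involutive ConicInversion.contMDiff_inversion
      ConicInversion.inversion_involutive x x'
  rw [hiso]
  refine ⟨?_, hupper x x'⟩
  have hr := ConicInversion.halfLine_pos x.2
  have hr' := ConicInversion.halfLine_pos x'.2
  have h := hlower (ConicInversion.inversion x) (ConicInversion.inversion x')
  rw [ConicInversion.inversion_involutive x, ConicInversion.inversion_involutive x'] at h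
  -- At the inverted points the weight is `1 / (r r')`; multiplying by `c` cancels it on the left
  -- and cancels `A` on the right.
  obtain ⟨c, hc⟩ : ∃ c : ℝ, c = A⁻¹ * ((x.2 : ℝ) * x'.2) := ⟨_, rfl⟩
  have hc0 : 0 ≤ c := hc ▸ by positivity
  have h2 := mul_le_mul_right h (ENNReal.ofReal c)
  rw [← mul_assoc, ← mul_assoc, ← ENNReal.ofReal_mul hc0, ← ENNReal.ofReal_mul hc0] at h2
  convert h2 using 3
  · change A⁻¹ = c * (1 / (x.2 : ℝ) * (1 / (x'.2 : ℝ)))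
    rw [hc]
    field_simp
  · rw [hc]
    field_simp
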